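/- Let $G=(V,E,w)$ be a finite connected simple undirected graph with positive edge weights $w:E\to\mathbb{R}_{>0}$. For such a weighted graph $H$ (connected or not) let $t_w(H)=\sum_T\prod_{e\in E(T)}w(e)$, the sum being over all spanning trees $T$ of $H$, and let $\tau_w(H)=\log t_w(H)$ if $t_w(H)>0$ and $\tau_w(H)=0$ otherwise. Orient the edges of $G$ arbitrarily and let $v_0\in V$ be an arbitrary vertex (the anchor). Let $A$ be the incidence matrix of the oriented graph (the column of an edge with head $u$ and tail $v$ is $e_u-e_v$) with the row of $v_0$ removed, let $W$ be the diagonal matrix of the edge weights, and let $L_G=AWA^\top$ be the reduced weighted Laplacian. For $u,v\in V$ let $a_{uv}$ be the vector $e_u-e_v$ with the coordinate of $v_0$ removed. Then $L_G$ is invertible, and with $\Delta^G_{uv}=a_{uv}^\top L_G^{-1}a_{uv}$ the following hold. 1. (Adding an edge.) Let $u\ne v$ with $\{u,v\}\notin E$, let $w_{uv}>0$, and let $G^+$ be the graph obtained from $G$ by adding the edge $\{u,v\}$ with weight $w_{uv}$. Then $1+w_{uv}\Delta^G_{uv}>0$ and $$\tau_w(G^+)=\tau_w(G)+\log\bigl(1+w_{uv}\Delta^G_{uv}\bigr).$$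 2. (Removing an edge.) Let $\{p,q\}\in E$ have weight $w_{pq}$, and let $G^-$ be the graph obtained from $G$ by removing the edge $\{p,q\}$. If $G^-$ is connected, then $1-w_{pq}\Delta^G_{pq}>0$ and $$\tau_w(G^-)=\tau_w(G)+\log\bigl(1-w_{pq}\Delta^G_{pq}\bigr).$$ If $G^-$ is not connected, then $1-w_{pq}\Delta^G_{pq}=0$, so that the logarithm is undefined. -/

import Mathlib

open scoped Matrix

/-- A simple undirected graph with a positive weight on each edge. The value of `weight` at a pair
that is not an edge is never used. -/
structure WeightedGraph (V : Type*) where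
  graph : SimpleGraph V
  weight : Sym2 V → ℝ
  weight_pos : ∀ e ∈ graph.edgeSet, 0 < weight e

/-- An orientation of the edges: each edge `e = {tail e, head e}` gets a tail and a head. -/
structure EdgeOrientation {V : Type*} (G : SimpleGraph V) where
  tail : G.edgeSet → V
  head : G.edgeSet → V
  ends_eq : ∀ e : G.edgeSet, s(tail e, head e) = (e : Sym2 V)

namespace WeightedGraph

variable {V : Type*}

/-- The graph obtained by giving the pair `{u, v}` the weight `w` and making it an edge. -/
noncomputable def addEdge [DecidableEq V] (G : WeightedGraph V) (u v : V) (w : ℝ) (hw : 0 < w) :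
    WeightedGraph V where
  graph := G.graph ⊔ SimpleGraph.edge u v
  weight := Function.update G.weight s(u, v) w
  weight_pos := by
    intro e he
    by_cases h : e = s(u, v)
    · subst h
      simpa using hw
    · rw [Function.update_of_ne h]
      apply G.weight_pos
      rw [SimpleGraph.edgeSet_sup] at he
      rcases he with he | he
      · exact he
      · exact absurd (SimpleGraph.edgeSet_fromEdgeSet {s(u, v)} ▸ he).1 h

/-- The graph obtained by removing the edge `{p, q}`. -/
def deleteEdge (G : WeightedGraph V) (p q : V) : WeightedGraph V where
  graph := G.graph.deleteEdges {s(p, q)}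
  weight := G.weight
  weight_pos := by
    intro e he
    rw [SimpleGraph.edgeSet_deleteEdges] at he
    exact G.weight_pos e he.1

variable [Fintype V]

open Classical in
/-- The spanning trees of a graph: the trees on the same vertex set all of whose edges are edges
of the graph. -/
noncomputable def spanningTrees (G : WeightedGraph V) : Finset (SimpleGraph V) :=
  Finset.univ.filter fun T => T ≤ G.graph ∧ T.IsTree

open Classical in
/-- The value of a spanning tree: the product of the weights of its edges. -/
noncomputable def treeValue (G : WeightedGraph V) (T : SimpleGraph V) : ℝ :=
  ∏ e ∈ T.edgeFinset, G.weight e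

/-- The weighted number of spanning trees. -/
noncomputable def weightedTreeCount (G : WeightedGraph V) : ℝ :=
  ∑ T ∈ G.spanningTrees, G.treeValue T

open Classical in
/-- The weighted tree-connectivity. -/
noncomputable def treeConnectivity (G : WeightedGraph V) : ℝ :=
  if 0 < G.weightedTreeCount then Real.log G.weightedTreeCount else 0

variable [DecidableEq V]

/-- The vector `e_u - e_v` with the coordinate of the anchor `v₀` removed. -/
def reducedEdgeVector (v₀ u v : V) : {x : V // x ≠ v₀} → ℝ :=
  fun x => (Pi.single u 1 - Pi.single v 1 : V → ℝ) x

/-- The incidence matrix of the oriented graph: the column of an edge is `e_head - e_tail`. -/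
def incidenceMatrix (G : WeightedGraph V) (o : EdgeOrientation G.graph) :
    Matrix V G.graph.edgeSet ℝ :=
  Matrix.of fun x e => (Pi.single (o.head e) 1 - Pi.single (o.tail e) 1 : V → ℝ) x

/-- The reduced incidence matrix: the row of the anchor `v₀` is removed. -/
def reducedIncidenceMatrix (G : WeightedGraph V) (o : EdgeOrientation G.graph) (v₀ : V) :
    Matrix {x : V // x ≠ v₀} G.graph.edgeSet ℝ :=
  (G.incidenceMatrix o).submatrix Subtype.val id

open Classical in
/-- The reduced weighted Laplacian `A W Aᵀ`. -/
noncomputable def reducedLaplacian (G : WeightedGraph V) (o : EdgeOrientation G.graph) (v₀ : V) :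
    Matrix {x : V // x ≠ v₀} {x : V // x ≠ v₀} ℝ :=
  G.reducedIncidenceMatrix o v₀ *
    Matrix.diagonal (fun e : G.graph.edgeSet => G.weight (e : Sym2 V)) *
      (G.reducedIncidenceMatrix o v₀)ᵀ

/-- The quantity `Δ_uv = a_uvᵀ L⁻¹ a_uv`. -/
noncomputable def delta (G : WeightedGraph V) (o : EdgeOrientation G.graph) (v₀ u v : V) : ℝ :=
  reducedEdgeVector v₀ u v ⬝ᵥ ((G.reducedLaplacian o v₀)⁻¹ *ᵥ reducedEdgeVector v₀ u v)

end WeightedGraph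

/-! The reduced Laplacian is the sum over the edges of `w(e) a_e a_eᵀ`, so adding or removing one
edge is a rank-one update, and the matrix determinant lemma multiplies its determinant by `1 ± wΔ`.
The weighted matrix-tree theorem (`det_reducedLaplacian`) turns this into an identity between tree
counts. The count is positive on connected graphs and zero on disconnected ones, which decides the
sign or vanishing of the factor; logarithms come last.

The matrix-tree theorem follows from Cauchy–Binet: among sets of `|V| - 1` edges, spanning trees
have determinant 1 by unimodularity and all others have determinant 0. -/

namespace Matrix

variable {n E R : Type*} [Fintype n] [DecidableEq n] [CommRing R]

/-- Row `i` of the sum is a combination of the vectors `a e`, so multilinearity chooses one `e` for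
each row; a repeated choice gives two equal rows. -/
theorem det_sum_smul_vecMulVec_self_eq_sum_piFinset [DecidableEq E] (F : Finset E) (w : E → R)
    (a : E → n → R) :
    (∑ e ∈ F, w e • vecMulVec (a e) (a e)).det =
      ∑ f ∈ (Fintype.piFinset fun _ : n => F) with Function.Injective f,
        (∏ i, w (f i)) * ((∏ i, a (f i) i) * (of fun i => a (f i)).det) := by
  have hrow : (∑ e ∈ F, w e • vecMulVec (a e) (a e)) =
      fun i => ∑ e ∈ F, (w e * a e i) • a e := by
    ext i j
    simp [Matrix.sum_apply, Finset.sum_apply, vecMulVec_apply, mul_assoc]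
  have hexp : (∑ e ∈ F, w e • vecMulVec (a e) (a e)).det =
      ∑ f ∈ Fintype.piFinset fun _ : n => F,
        (∏ i, w (f i)) * ((∏ i, a (f i) i) * (of fun i => a (f i)).det) := by
    rw [hrow]
    change (detRowAlternating (R := R) (n := n)).toMultilinearMap _ = _
    rw [MultilinearMap.map_sum_finset]
    refine Finset.sum_congr rfl fun f _ => ?_
    rw [MultilinearMap.map_smul_univ, Finset.prod_mul_distrib, smul_eq_mul, mul_assoc]
    rfl
  rw [hexp, Finset.sum_filter_of_ne]
  intro f _ hf
  by_contra hinj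
  obtain ⟨i, j, hij, hne⟩ : ∃ i j, f i = f j ∧ i ≠ j := by
    simpa [Function.Injective] using hinj
  apply hf
  rw [det_zero_of_row_eq hne (by ext k; simp [hij]), mul_zero, mul_zero]

/-- A form of the Cauchy–Binet formula for weighted sums of rank-one matrices. -/
theorem det_sum_smul_vecMulVec_self [DecidableEq E] (F : Finset E) (w : E → R)
    (a : E → n → R) :
    (∑ e ∈ F, w e • vecMulVec (a e) (a e)).det =
      ∑ S ∈ F.powersetCard (Fintype.card n),
        (∏ e ∈ S, w e) * (∑ e ∈ S, vecMulVec (a e) (a e)).det := by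
  have hmaps : ∀ f ∈ (Fintype.piFinset fun _ : n => F).filter Function.Injective,
      Finset.univ.image f ∈ F.powersetCard (Fintype.card n) := by
    intro f hf
    rw [Finset.mem_filter, Fintype.mem_piFinset] at hf
    rw [Finset.mem_powersetCard, Finset.card_image_of_injective _ hf.2]
    refine ⟨fun e he => ?_, Finset.card_univ⟩
    obtain ⟨i, -, rfl⟩ := Finset.mem_image.1 he
    exact hf.1 i
  rw [det_sum_smul_vecMulVec_self_eq_sum_piFinset, ← Finset.sum_fiberwise_of_maps_to hmaps]
  refine Finset.sum_congr rfl fun S hS => ?_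
  rw [Finset.mem_powersetCard] at hS
  -- The same expansion with unit weights identifies the sum over choices with image `S`, on which
  -- the weight product is constant.
  have hone := det_sum_smul_vecMulVec_self_eq_sum_piFinset S (fun _ => (1 : R)) a
  simp only [one_smul, Finset.prod_const_one, one_mul] at hone
  rw [hone, Finset.mul_sum]
  have hset : ((Fintype.piFinset fun _ : n => F).filter Function.Injective).filter
      (fun f => Finset.univ.image f = S) =
        (Fintype.piFinset fun _ : n => S).filter Function.Injective := by
    ext f
    simp only [Finset.mem_filter, Fintype.mem_piFinset]
    constructor
    · rintro ⟨⟨-, hf⟩, rfl⟩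
      exact ⟨fun i => Finset.mem_image_of_mem _ (Finset.mem_univ i), hf⟩
    · rintro ⟨hfS, hf⟩
      refine ⟨⟨fun i => hS.1 (hfS i), hf⟩, Finset.eq_of_subset_of_card_le ?_ ?_⟩
      · intro e he
        obtain ⟨i, -, rfl⟩ := Finset.mem_image.1 he
        exact hfS i
      · rw [Finset.card_image_of_injective _ hf, hS.2, Finset.card_univ]
  rw [hset]
  refine Finset.sum_congr rfl fun f hf => ?_
  rw [← hset, Finset.mem_filter, Finset.mem_filter] at hf
  rw [← hf.2, Finset.prod_image fun i _ j _ h => hf.1.2 h]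

theorem det_add_smul_vecMulVec_self {M : Matrix n n R} (hM : IsUnit M.det) (c : R) (a : n → R) :
    (M + c • vecMulVec a a).det = M.det * (1 + c * (a ⬝ᵥ (M⁻¹ *ᵥ a))) := by
  have h := det_add_replicateCol_mul_replicateRow (ι := Unit) hM (c • a) a
  rw [← vecMulVec_eq, smul_vecMulVec] at h
  rw [h, Matrix.mul_assoc, ← replicateCol_mulVec, det_unique (n := Unit), Matrix.add_apply,
    Matrix.one_apply_eq, replicateRow_mul_replicateCol_apply, mulVec_smul, dotProduct_smul,
    smul_eq_mul]

end Matrix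

/-! ### Edge vectors of trees and of disconnected graphs -/

namespace SimpleGraph

variable {V : Type*} [DecidableEq V]

/-- The vector `e_u - e_v` over `R` with the coordinate of `v₀` removed. -/
def reducedDifference (R : Type*) [CommRing R] (v₀ u v : V) : {x : V // x ≠ v₀} → R :=
  fun x => (Pi.single u 1 - Pi.single v 1 : V → R) x

/-- The vector `e_u - e_v` of the ends of an unordered pair, with the coordinate of `v₀` removed.
The sign depends on the chosen representative. -/
noncomputable def edgeVector (R : Type*) [CommRing R] (v₀ : V) (e : Sym2 V) :
    {x : V // x ≠ v₀} → R :=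
  reducedDifference R v₀ e.out.1 e.out.2

theorem edgeVector_mk (R : Type*) [CommRing R] (v₀ u v : V) :
    edgeVector R v₀ s(u, v) = reducedDifference R v₀ u v ∨
    edgeVector R v₀ s(u, v) = -reducedDifference R v₀ u v := by
  have h : s((Quot.out s(u, v)).1, (Quot.out s(u, v)).2) = s(u, v) := Quot.out_eq s(u, v)
  rw [Sym2.eq_iff] at h
  rcases h with ⟨h₁, h₂⟩ | ⟨h₁, h₂⟩
  · left
    rw [edgeVector, h₁, h₂]
  · right
    rw [edgeVector, h₁, h₂]
    ext x
    simp [reducedDifference]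

theorem vecMulVec_edgeVector_mk (v₀ u v : V) :
    Matrix.vecMulVec (edgeVector ℝ v₀ s(u, v)) (edgeVector ℝ v₀ s(u, v)) =
      Matrix.vecMulVec (WeightedGraph.reducedEdgeVector v₀ u v)
        (WeightedGraph.reducedEdgeVector v₀ u v) := by
  rcases edgeVector_mk ℝ v₀ u v with h | h <;> rw [h]
  · rfl
  · rw [Matrix.neg_vecMulVec, Matrix.vecMulVec_neg, neg_neg]
    rfl

/-- The edge vectors telescope along a walk. A general ring is allowed because unimodularity needs
integer coefficients. -/
theorem Reachable.exists_sum_smul_edgeVector (R : Type*) [CommRing R] {T : SimpleGraph V}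
    [Fintype T.edgeSet] (v₀ : V) {u v : V} (h : T.Reachable u v) :
    ∃ c : Sym2 V → R, ∑ e ∈ T.edgeFinset, c e • edgeVector R v₀ e =
      reducedDifference R v₀ u v := by
  obtain ⟨p⟩ := h
  induction p with
  | nil => exact ⟨0, by ext; simp [reducedDifference]⟩
  | @cons u v w huv p ih =>
    obtain ⟨c, hc⟩ := ih
    have hmem : s(u, v) ∈ T.edgeFinset := by simpa using huv
    obtain ⟨k, hk⟩ : ∃ k : R, k • edgeVector R v₀ s(u, v) =
        reducedDifference R v₀ u v := by
      rcases edgeVector_mk R v₀ u v with h | h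
      · exact ⟨1, by rw [h, one_smul]⟩
      · exact ⟨-1, by rw [h, neg_smul, one_smul, neg_neg]⟩
    refine ⟨c + Pi.single s(u, v) k, ?_⟩
    simp only [Pi.add_apply, add_smul, Finset.sum_add_distrib, hc]
    rw [Finset.sum_eq_single_of_mem _ hmem (fun e _ he => by simp [Pi.single_eq_of_ne he])]
    rw [Pi.single_eq_same, hk]
    ext x
    simp [reducedDifference]

variable [Fintype V]

/-- The reduced incidence matrix of a tree is square and has an integral right inverse, so its
determinant is `±1`, with square 1. -/
theorem IsTree.det_sum_vecMulVec_edgeVector {T : SimpleGraph V} [Fintype T.edgeSet]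
    (hT : T.IsTree) (v₀ : V) :
    (∑ e ∈ T.edgeFinset, Matrix.vecMulVec (edgeVector ℝ v₀ e) (edgeVector ℝ v₀ e)).det = 1 := by
  have hcard : Fintype.card {x : V // x ≠ v₀} = Fintype.card T.edgeFinset := by
    have h := hT.card_edgeFinset
    rw [Fintype.card_subtype_compl, Fintype.card_subtype_eq, Fintype.card_coe]
    omega
  let φ := Fintype.equivOfCardEq hcard
  -- Without the anchor coordinate, `e_x - e_{v₀}` is a standard basis vector, so these coefficients
  -- form the columns of the inverse.
  choose c hc using fun x : {x : V // x ≠ v₀} =>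
    (hT.connected.preconnected x v₀).exists_sum_smul_edgeVector ℤ v₀
  let A : Matrix {x : V // x ≠ v₀} {x : V // x ≠ v₀} ℤ :=
    Matrix.of fun x y => edgeVector ℤ v₀ (φ y) x
  let B : Matrix {x : V // x ≠ v₀} {x : V // x ≠ v₀} ℤ := Matrix.of fun y z => c z (φ y)
  have hAB : A * B = 1 := by
    ext x z
    have h := congrFun (hc z) x
    rw [Finset.sum_apply, ← Finset.sum_coe_sort, ← φ.sum_comp] at h
    rw [Matrix.mul_apply]
    simp only [A, B, Matrix.of_apply]
    simp only [Pi.smul_apply, smul_eq_mul, mul_comm (c z _)] at h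
    rw [h, reducedDifference, Pi.sub_apply, Pi.single_eq_of_ne x.2, sub_zero, Matrix.one_apply, Pi.single_apply]
    simp [Subtype.ext_iff]
  have hA : A.det * A.det = 1 := by
    apply Int.isUnit_mul_self
    apply IsUnit.of_mul_eq_one B.det
    rw [← Matrix.det_mul, hAB, Matrix.det_one]
  have hcast : (∑ e ∈ T.edgeFinset,
      Matrix.vecMulVec (edgeVector ℝ v₀ e) (edgeVector ℝ v₀ e)) =
        (Int.castRingHom ℝ).mapMatrix (A * Aᵀ) := by
    ext x y
    rw [Matrix.sum_apply, ← Finset.sum_coe_sort, ← φ.sum_comp]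
    simp [Matrix.mul_apply, A, Matrix.vecMulVec_apply, edgeVector,
      reducedDifference, Pi.single_apply]
  rw [hcast, ← RingHom.map_det, Matrix.det_mul, Matrix.det_transpose, hA, map_one]

/-- The indicator of a component avoiding `v₀` is nonzero and orthogonal to every edge vector, hence
lies in the kernel. -/
theorem det_sum_vecMulVec_edgeVector_of_not_connected {T : SimpleGraph V} [Fintype T.edgeSet]
    (hT : ¬ T.Connected) (v₀ : V) :
    (∑ e ∈ T.edgeFinset, Matrix.vecMulVec (edgeVector ℝ v₀ e) (edgeVector ℝ v₀ e)).det = 0 := by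
  classical
  obtain ⟨z, hz⟩ : ∃ z, ¬ T.Reachable v₀ z := by
    by_contra! h
    exact hT ((connected_iff_exists_forall_reachable T).2 ⟨v₀, h⟩)
  let χ : V → ℝ := fun x => if T.Reachable z x then 1 else 0
  have hχ : χ v₀ = 0 := if_neg fun h => hz h.symm
  rw [← Matrix.exists_mulVec_eq_zero_iff]
  refine ⟨fun x => χ x, fun h => ?_, ?_⟩
  · have hne : z ≠ v₀ := by
      rintro rfl
      exact hz (Reachable.refl _)
    have := congrFun h ⟨z, hne⟩
    simp [χ] at this
  · rw [Matrix.sum_mulVec]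
    refine Finset.sum_eq_zero fun e he => ?_
    induction e with
    | h u v =>
    have huv : T.Adj u v := by simpa using he
    have hdot : reducedDifference ℝ v₀ u v ⬝ᵥ (fun x : {x : V // x ≠ v₀} => χ x) = 0 := by
      have hall : (Pi.single u 1 - Pi.single v 1 : V → ℝ) ⬝ᵥ χ = 0 := by
        have : T.Reachable z u ↔ T.Reachable z v :=
          ⟨fun h => h.trans huv.reachable, fun h => h.trans huv.symm.reachable⟩
        simp [sub_dotProduct, χ, this]
      -- Dropping the anchor coordinate changes nothing, since `χ` vanishes there.
      rw [dotProduct, ← Fintype.sum_subtype_add_sum_subtype (· ≠ v₀),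
        Fintype.sum_eq_zero (fun x : {x : V // ¬ x ≠ v₀} => _)
          (fun x => by rw [not_not.1 x.2, hχ, mul_zero]), add_zero] at hall
      exact hall
    have hdot' : edgeVector ℝ v₀ s(u, v) ⬝ᵥ (fun x : {x : V // x ≠ v₀} => χ x) = 0 := by
      rcases edgeVector_mk ℝ v₀ u v with h | h
      · rw [h, hdot]
      · rw [h, neg_dotProduct, hdot, neg_zero]
    rw [Matrix.vecMulVec_mulVec, hdot']
    simp

end SimpleGraph

/-! ### Matrix-tree theorem and edge updates -/

namespace WeightedGraph

open SimpleGraph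

variable {V : Type*}

/-- Every graph has an orientation. -/
noncomputable def defaultOrientation (G : SimpleGraph V) : EdgeOrientation G where
  tail e := (e : Sym2 V).out.1
  head e := (e : Sym2 V).out.2
  ends_eq e := Quot.out_eq (e : Sym2 V)

variable [Fintype V]

theorem mem_spanningTrees {G : WeightedGraph V} {T : SimpleGraph V} :
    T ∈ G.spanningTrees ↔ T ≤ G.graph ∧ T.IsTree := by
  simp [spanningTrees]

theorem weightedTreeCount_pos {G : WeightedGraph V} (hG : G.graph.Connected) :
    0 < G.weightedTreeCount := by
  classical
  obtain ⟨T, hle, hT⟩ := hG.exists_isTree_le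
  refine Finset.sum_pos (fun T' hT' => Finset.prod_pos fun e he => G.weight_pos e ?_)
    ⟨T, mem_spanningTrees.2 ⟨hle, hT⟩⟩
  exact SimpleGraph.edgeSet_mono (mem_spanningTrees.1 hT').1 (SimpleGraph.mem_edgeFinset.1 he)

theorem weightedTreeCount_eq_zero {G : WeightedGraph V} (hG : ¬ G.graph.Connected) :
    G.weightedTreeCount = 0 := by
  classical
  refine Finset.sum_eq_zero fun T hT => absurd ?_ hG
  obtain ⟨hle, htree⟩ := mem_spanningTrees.1 hT
  exact htree.connected.mono hle

theorem treeConnectivity_of_connected {G : WeightedGraph V} (hG : G.graph.Connected) :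
    G.treeConnectivity = Real.log G.weightedTreeCount :=
  if_pos (weightedTreeCount_pos hG)

variable [DecidableEq V]

/-- The reduced Laplacian as a sum of rank-one matrices over the edges. -/
theorem reducedLaplacian_eq_sum (G : WeightedGraph V) [inst : Fintype G.graph.edgeSet]
    (o : EdgeOrientation G.graph) (v₀ : V) :
    G.reducedLaplacian o v₀ = ∑ e ∈ G.graph.edgeFinset, G.weight e •
      Matrix.vecMulVec (edgeVector ℝ v₀ e) (edgeVector ℝ v₀ e) := by
  classical
  obtain rfl : inst = G.graph.fintypeEdgeSet := Subsingleton.elim _ _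
  -- The outer product does not see the sign, so the orientation is irrelevant.
  have hterm : ∀ e : G.graph.edgeSet,
      Matrix.vecMulVec (edgeVector ℝ v₀ e) (edgeVector ℝ v₀ e) =
        Matrix.vecMulVec (reducedEdgeVector v₀ (o.head e) (o.tail e))
          (reducedEdgeVector v₀ (o.head e) (o.tail e)) := by
    intro e
    rw [← vecMulVec_edgeVector_mk, Sym2.eq_swap, o.ends_eq]
  rw [Finset.sum_subtype G.graph.edgeFinset (F := G.graph.fintypeEdgeSet)
    (fun e => SimpleGraph.mem_edgeFinset)]
  simp only [hterm]
  ext x y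
  rw [reducedLaplacian, Matrix.mul_apply, Matrix.sum_apply]
  refine Finset.sum_congr (by ext; simp) fun e _ => ?_
  rw [Matrix.mul_diagonal, Matrix.smul_apply, Matrix.vecMulVec_apply, Matrix.transpose_apply,
    smul_eq_mul]
  simp only [reducedIncidenceMatrix, incidenceMatrix, reducedEdgeVector, Matrix.submatrix_apply,
    Matrix.of_apply, id]
  ring

/-- The weighted matrix-tree theorem. -/
theorem det_reducedLaplacian (G : WeightedGraph V) (o : EdgeOrientation G.graph) (v₀ : V) :
    (G.reducedLaplacian o v₀).det = G.weightedTreeCount := by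
  classical
  have hcardV : Fintype.card {x : V // x ≠ v₀} + 1 = Fintype.card V := by
    have := Fintype.card_pos_iff.2 ⟨v₀⟩
    rw [Fintype.card_subtype_compl, Fintype.card_subtype_eq]
    omega
  rw [reducedLaplacian_eq_sum, Matrix.det_sum_smul_vecMulVec_self, weightedTreeCount]
  symm
  have himage : G.spanningTrees.image (fun T => T.edgeFinset) ⊆
      G.graph.edgeFinset.powersetCard (Fintype.card {x : V // x ≠ v₀}) := by
    intro S hS
    obtain ⟨T, hT, rfl⟩ := Finset.mem_image.1 hS
    obtain ⟨hle, htree⟩ := mem_spanningTrees.1 hT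
    rw [Finset.mem_powersetCard]
    refine ⟨SimpleGraph.edgeFinset_subset_edgeFinset.2 hle, ?_⟩
    have := htree.card_edgeFinset
    omega
  rw [← Finset.sum_subset himage, Finset.sum_image]
  · refine Finset.sum_congr rfl fun T hT => ?_
    obtain ⟨-, htree⟩ := mem_spanningTrees.1 hT
    rw [htree.det_sum_vecMulVec_edgeVector, mul_one, treeValue]
  · intro T _ T' _ h
    exact SimpleGraph.edgeFinset_inj.1 h
  · intro S hS hS'
    rw [Finset.mem_powersetCard] at hS
    obtain ⟨T, hedge⟩ : ∃ T : SimpleGraph V, T.edgeSet = S := by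
      refine ⟨fromEdgeSet S, ?_⟩
      rw [edgeSet_fromEdgeSet, sdiff_eq_left, Set.disjoint_left]
      -- Edges of `G` are not loops, so `fromEdgeSet` discards nothing from `S`.
      intro e he hdiag
      exact G.graph.not_isDiag_of_mem_edgeSet
        (SimpleGraph.mem_edgeFinset.1 (hS.1 he)) hdiag
    have hfin : T.edgeFinset = S := by
      rw [← Finset.coe_inj, SimpleGraph.coe_edgeFinset, hedge]
    have hle : T ≤ G.graph := by
      rw [← SimpleGraph.edgeFinset_subset_edgeFinset, hfin]
      exact hS.1
    -- A connected graph with `|V| - 1` edges is a tree, so its edge set would lie in the image.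
    have hnot : ¬ T.Connected := by
      intro hconn
      apply hS'
      refine Finset.mem_image.2 ⟨T, mem_spanningTrees.2 ⟨hle, ?_⟩, hfin⟩
      rw [SimpleGraph.isTree_iff_connected_and_card, hedge, Nat.card_eq_fintype_card,
        Nat.card_eq_fintype_card, ← hcardV, ← hS.2]
      exact ⟨hconn, by simp⟩
    have hdet := det_sum_vecMulVec_edgeVector_of_not_connected hnot v₀
    rw [hfin] at hdet
    rw [hdet, mul_zero]

theorem isUnit_det_reducedLaplacian {G : WeightedGraph V} (hG : G.graph.Connected)
    (o : EdgeOrientation G.graph) (v₀ : V) : IsUnit (G.reducedLaplacian o v₀).det := by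
  rw [det_reducedLaplacian]
  exact (weightedTreeCount_pos hG).ne'.isUnit

/-- A rank-one change of the reduced Laplacian multiplies the weighted tree count by the factor of
the matrix determinant lemma. -/
theorem weightedTreeCount_of_reducedLaplacian_eq_add {G H : WeightedGraph V}
    (hG : G.graph.Connected) (o : EdgeOrientation G.graph) (o' : EdgeOrientation H.graph)
    (v₀ u v : V) (c : ℝ)
    (h : H.reducedLaplacian o' v₀ = G.reducedLaplacian o v₀ +
      c • Matrix.vecMulVec (reducedEdgeVector v₀ u v) (reducedEdgeVector v₀ u v)) :
    H.weightedTreeCount = G.weightedTreeCount * (1 + c * G.delta o v₀ u v) := by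
  rw [← det_reducedLaplacian H o' v₀, h,
    Matrix.det_add_smul_vecMulVec_self (isUnit_det_reducedLaplacian hG o v₀),
    det_reducedLaplacian, delta]

theorem weightedTreeCount_addEdge {G : WeightedGraph V} (hG : G.graph.Connected)
    (o : EdgeOrientation G.graph) (v₀ : V) {u v : V} {w : ℝ} (hw : 0 < w) (huv : u ≠ v)
    (hadj : ¬ G.graph.Adj u v) :
    (G.addEdge u v w hw).weightedTreeCount =
      G.weightedTreeCount * (1 + w * G.delta o v₀ u v) := by
  classical
  refine weightedTreeCount_of_reducedLaplacian_eq_add hG o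
    (defaultOrientation (G.addEdge u v w hw).graph) v₀ u v w ?_
  have hedges : (G.addEdge u v w hw).graph.edgeFinset =
      G.graph.edgeFinset.cons s(u, v) (by simpa using hadj) := by
    rw [← G.graph.edgeFinset_sup_edge hadj huv]
    exact SimpleGraph.edgeFinset_inj.2 rfl
  rw [reducedLaplacian_eq_sum, reducedLaplacian_eq_sum, hedges, Finset.sum_cons, add_comm,
    vecMulVec_edgeVector_mk]
  congr 1
  · refine Finset.sum_congr rfl fun e he => congrArg₂ _ ?_ rfl
    have hne : e ≠ s(u, v) := by
      rintro rfl
      exact hadj (by simpa using he)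
    exact Function.update_of_ne hne _ _
  · exact congrArg₂ _ (Function.update_self _ _ _) rfl

/-- Only the Laplacian of `G` is inverted, so the identity also covers removal of a bridge, where
the left side is 0. -/
theorem weightedTreeCount_deleteEdge {G : WeightedGraph V} (hG : G.graph.Connected)
    (o : EdgeOrientation G.graph) (v₀ : V) {p q : V} (hadj : G.graph.Adj p q) :
    (G.deleteEdge p q).weightedTreeCount =
      G.weightedTreeCount * (1 - G.weight s(p, q) * G.delta o v₀ p q) := by
  classical
  rw [sub_eq_add_neg, ← neg_mul]
  refine weightedTreeCount_of_reducedLaplacian_eq_add hG o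
    (defaultOrientation (G.deleteEdge p q).graph) v₀ p q _ ?_
  have hedges : (G.deleteEdge p q).graph.edgeFinset = G.graph.edgeFinset.erase s(p, q) := by
    ext e
    rw [SimpleGraph.mem_edgeFinset, deleteEdge, SimpleGraph.edgeSet_deleteEdges]
    simp [and_comm]
  have hmem : s(p, q) ∈ G.graph.edgeFinset := by simpa using hadj
  rw [reducedLaplacian_eq_sum, reducedLaplacian_eq_sum, hedges,
    ← Finset.sum_erase_add _ _ hmem, vecMulVec_edgeVector_mk, neg_smul, add_neg_cancel_right]
  rfl

end WeightedGraph

open WeightedGraph in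
theorem mainTheorem9 {V : Type*} [Fintype V] [DecidableEq V] (G : WeightedGraph V)
    (hG : G.graph.Connected) (o : EdgeOrientation G.graph) (v₀ : V) :
    IsUnit (G.reducedLaplacian o v₀).det ∧
    (∀ (u v : V) (w : ℝ) (hw : 0 < w), u ≠ v → ¬ G.graph.Adj u v →
      0 < 1 + w * G.delta o v₀ u v ∧
      (G.addEdge u v w hw).treeConnectivity =
        G.treeConnectivity + Real.log (1 + w * G.delta o v₀ u v)) ∧
    (∀ p q : V, G.graph.Adj p q →
      ((G.deleteEdge p q).graph.Connected →
        0 < 1 - G.weight s(p, q) * G.delta o v₀ p q ∧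
        (G.deleteEdge p q).treeConnectivity =
          G.treeConnectivity + Real.log (1 - G.weight s(p, q) * G.delta o v₀ p q)) ∧
      (¬ (G.deleteEdge p q).graph.Connected →
        1 - G.weight s(p, q) * G.delta o v₀ p q = 0)) := by
  have hpos := weightedTreeCount_pos hG
  have hconn : ∀ {H : WeightedGraph V} {c : ℝ}, H.graph.Connected →
      H.weightedTreeCount = G.weightedTreeCount * c →
      0 < c ∧ H.treeConnectivity = G.treeConnectivity + Real.log c := by
    intro H c hH h
    have hc : 0 < c := pos_of_mul_pos_right (h ▸ weightedTreeCount_pos hH) hpos.le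
    rw [treeConnectivity_of_connected hH, treeConnectivity_of_connected hG, h,
      Real.log_mul hpos.ne' hc.ne']
    exact ⟨hc, rfl⟩
  refine ⟨isUnit_det_reducedLaplacian hG o v₀, fun u v w hw huv hadj => ?_,
    fun p q hadj => ⟨fun hH => ?_, fun hH => ?_⟩⟩
  · exact hconn (hG.mono le_sup_left) (weightedTreeCount_addEdge hG o v₀ hw huv hadj)
  · exact hconn hH (weightedTreeCount_deleteEdge hG o v₀ hadj)
  · have h := weightedTreeCount_deleteEdge hG o v₀ hadj
    rw [weightedTreeCount_eq_zero hH] at h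
    exact (mul_eq_zero.1 h.symm).resolve_left hpos.ne'
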